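/- Let $p\ge 1$ and $K\ge 2$ be integers, let $n_1,\dots,n_K\ge 1$ be integers and $N=n_1+\cdots+n_K$, and for each $j=1,\dots,K$ let $A_j=(a_{j,1},\dots,a_{j,n_j})$ be a finite sample of points of $\mathbb R^p$ (repetitions allowed). Let $\|\cdot\|$ be the Euclidean norm. For $0<\alpha\le 2$ put \[ g_\alpha(A_j,A_k)=\frac1{n_jn_k}\sum_{i=1}^{n_j}\sum_{m=1}^{n_k}\|a_{j,i}-a_{k,m}\|^\alpha, \] \[ d_\alpha(A_j,A_k)=\frac{n_jn_k}{n_j+n_k}\bigl[2g_\alpha(A_j,A_k)-g_\alpha(A_j,A_j)-g_\alpha(A_k,A_k)\bigr], \] \[ S_\alpha=S_\alpha(A_1,\dots,A_K)=\sum_{1\le j<k\le K}\frac{n_j+n_k}{2N}\,d_\alpha(A_j,A_k). \] Then the following statements hold. (i) $S_\alpha\ge 0$ for every $0<\alpha\le 2$. (ii) If $0<\alpha<2$, then $S_\alpha=0$ if and only if all the samples have the same empirical distribution, that is, the probability measures $\frac1{n_j}\sum_{i=1}^{n_j}\delta_{a_{j,i}}$, $j=1,\dots,K$, are all equal. (iii)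 $S_2=0$ if and only if all the samples have the same mean, that is, the vectors $\frac1{n_j}\sum_{i=1}^{n_j}a_{j,i}$, $j=1,\dots,K$, are all equal. -/

import Mathlib

open scoped BigOperators ENNReal

namespace Disco

/-- The Gini mean distance statistic `g_α(a, b)` of two finite samples in `ℝ^p`:
the average of `‖a_i - b_m‖ ^ α` over all pairs `(i, m)`, with the Euclidean norm. -/
noncomputable def gini {p m n : ℕ} (α : ℝ)
    (a : Fin m → EuclideanSpace ℝ (Fin p)) (b : Fin n → EuclideanSpace ℝ (Fin p)) : ℝ :=
  (1 / ((m : ℝ) * (n : ℝ))) * ∑ i : Fin m, ∑ l : Fin n, ‖a i - b l‖ ^ α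

/-- The `d_α`-distance between two finite samples of sizes `m` and `n`. -/
noncomputable def dDist {p m n : ℕ} (α : ℝ)
    (a : Fin m → EuclideanSpace ℝ (Fin p)) (b : Fin n → EuclideanSpace ℝ (Fin p)) : ℝ :=
  ((m : ℝ) * (n : ℝ) / ((m : ℝ) + (n : ℝ))) * (2 * gini α a b - gini α a a - gini α b b)

/-- The between-sample dispersion `S_α(A_1, …, A_K)` of samples of arbitrary sizes
`n_1, …, n_K`, with `N = n_1 + ⋯ + n_K`: the sum over the pairs `j < k` of
`((n_j + n_k) / (2 N)) * d_α(A_j, A_k)`. -/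
noncomputable def betweenDispersion {p K : ℕ} (α : ℝ) (n : Fin K → ℕ)
    (A : (j : Fin K) → Fin (n j) → EuclideanSpace ℝ (Fin p)) : ℝ :=
  ∑ j : Fin K, ∑ k ∈ Finset.univ.filter (fun k : Fin K => j < k),
    (((n j : ℝ) + (n k : ℝ)) / (2 * ∑ i : Fin K, (n i : ℝ))) * dDist α (A j) (A k)

/-- The empirical distribution of a finite sample: mass `1 / n` at each sample element,
counted with multiplicity. -/
noncomputable def empiricalDistribution {p n : ℕ}
    (a : Fin n → EuclideanSpace ℝ (Fin p)) :
    MeasureTheory.Measure (EuclideanSpace ℝ (Fin p)) :=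
  (n : ℝ≥0∞)⁻¹ • ∑ i : Fin n, MeasureTheory.Measure.dirac (a i)

/-- The (vector) mean of a finite sample. -/
noncomputable def sampleMean {p n : ℕ}
    (a : Fin n → EuclideanSpace ℝ (Fin p)) : EuclideanSpace ℝ (Fin p) :=
  (n : ℝ)⁻¹ • ∑ i : Fin n, a i

end Disco

namespace Disco

open MeasureTheory Set

/-! ### Fractional powers as mixtures of exponentials -/

section FractionalPower

variable {s : ℝ}

/-! Give the pooled points of two samples the weights `1/m` and `-1/n`, which sum to zero; then
`d_α` is a positive multiple of `-∑ c_i c_j ‖x_i - x_j‖^α`. For `α < 2`, `t^(α/2)` is a positive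
multiple of `∫ (1 - e^(-lt)) l^(-1-α/2) dl`, so this form is a mixture over `l > 0` of Gaussian
forms, each a positive multiple of the squared L² norm of a combination of Gaussians. If it
vanishes, so does such a combination for some `l`, and independence of exponentials kills the net
weight at each point (`sum_eq_zero_of_sum_mul_norm_rpow_eq_zero`). For `α = 2` expanding the square
leaves only the difference of the means (`sum_mul_sq_norm_sub`). `S_α` is a positively weighted sum
of the `d_α`. -/

theorem integrableOn_one_sub_exp_mul_rpow (hs0 : 0 < s) (hs1 : s < 1) {t : ℝ} (ht : 0 ≤ t) :
    IntegrableOn (fun l : ℝ => (1 - Real.exp (-(l * t))) * l ^ (-1 - s)) (Ioi 0) := by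
  have hmeas : ∀ S : Set ℝ, AEStronglyMeasurable
      (fun l : ℝ => (1 - Real.exp (-(l * t))) * l ^ (-1 - s)) (volume.restrict S) :=
    fun S => by
      apply Measurable.aestronglyMeasurable
      fun_prop
  rw [← Ioc_union_Ioi_eq_Ioi (zero_le_one' ℝ)]
  refine IntegrableOn.union ?_ ?_
  -- Near 0, `1 - e^(-lt) ≤ lt` lowers the singularity to `l^(-s)`; at infinity the factor is at
  -- most 1.
  · have h : IntegrableOn (fun l : ℝ => t * l ^ (-s)) (Ioc 0 1) := by
      refine Integrable.const_mul ?_ t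
      exact (intervalIntegrable_iff_integrableOn_Ioc_of_le zero_le_one).1
        (intervalIntegral.intervalIntegrable_rpow' (by linarith))
    refine h.mono' (hmeas _) ?_
    filter_upwards [ae_restrict_mem measurableSet_Ioc] with l hl
    have h1 : 0 ≤ 1 - Real.exp (-(l * t)) := by
      have := mul_nonneg hl.1.le ht
      simpa using this
    have h2 : 1 - Real.exp (-(l * t)) ≤ l * t := by
      linarith [Real.add_one_le_exp (-(l * t))]
    have h3 : l ^ (-s) = l * l ^ (-1 - s) := by
      rw [← Real.rpow_one_add' hl.1.le (by linarith)]
      ring_nf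
    have h4 : 0 ≤ l ^ (-1 - s) := Real.rpow_nonneg hl.1.le _
    rw [Real.norm_of_nonneg (mul_nonneg h1 h4), h3, ← mul_assoc, mul_comm t l]
    exact mul_le_mul_of_nonneg_right h2 h4
  · refine (integrableOn_Ioi_rpow_of_lt (show -1 - s < -1 by linarith) one_pos).mono' (hmeas _) ?_
    filter_upwards [ae_restrict_mem measurableSet_Ioi] with l hl
    have hl0 : (0 : ℝ) < l := one_pos.trans hl
    have h1 : 0 ≤ 1 - Real.exp (-(l * t)) := by
      have := mul_nonneg hl0.le ht
      simpa using this
    have h4 : 0 ≤ l ^ (-1 - s) := Real.rpow_nonneg hl0.le _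
    rw [Real.norm_of_nonneg (mul_nonneg h1 h4)]
    exact mul_le_of_le_one_left h4 (by linarith [Real.exp_pos (-(l * t))])

theorem integral_one_sub_exp_mul_rpow_pos (hs0 : 0 < s) (hs1 : s < 1) :
    0 < ∫ l in Ioi (0 : ℝ), (1 - Real.exp (-l)) * l ^ (-1 - s) := by
  have hpos : ∀ l ∈ Ioi (0 : ℝ), 0 < (1 - Real.exp (-l)) * l ^ (-1 - s) := fun l hl =>
    mul_pos (by simpa using hl) (Real.rpow_pos_of_pos hl _)
  rw [setIntegral_pos_iff_support_of_nonneg_ae]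
  · rw [inter_eq_right.2 fun l hl => Function.mem_support.2 (hpos l hl).ne']
    simp
  · filter_upwards [ae_restrict_mem measurableSet_Ioi] with l hl using (hpos l hl).le
  · simpa using integrableOn_one_sub_exp_mul_rpow hs0 hs1 zero_le_one

theorem integral_one_sub_exp_mul_rpow (hs0 : 0 < s) {t : ℝ} (ht : 0 ≤ t) :
    ∫ l in Ioi (0 : ℝ), (1 - Real.exp (-(l * t))) * l ^ (-1 - s) =
      t ^ s * ∫ l in Ioi (0 : ℝ), (1 - Real.exp (-l)) * l ^ (-1 - s) := by
  rcases ht.eq_or_lt with rfl | ht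
  · simp [Real.zero_rpow hs0.ne']
  have h := integral_comp_mul_right_Ioi
    (fun l : ℝ => (1 - Real.exp (-l)) * l ^ (-1 - s)) 0 ht
  rw [zero_mul, smul_eq_mul] at h
  have h2 : ∫ l in Ioi (0 : ℝ), (1 - Real.exp (-(l * t))) * (l * t) ^ (-1 - s) =
      t ^ (-1 - s) * ∫ l in Ioi (0 : ℝ), (1 - Real.exp (-(l * t))) * l ^ (-1 - s) := by
    rw [← integral_const_mul]
    refine setIntegral_congr_fun measurableSet_Ioi fun l hl => ?_
    simp only [Real.mul_rpow (le_of_lt hl) ht.le]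
    ring
  rw [h2] at h
  have h3 : t ^ s * t ^ (-1 - s) = t⁻¹ := by
    rw [← Real.rpow_add ht, ← Real.rpow_neg_one]
    ring_nf
  have h4 : t ^ (-1 - s) ≠ 0 := (Real.rpow_pos_of_pos ht _).ne'
  refine mul_left_cancel₀ h4 ?_
  rw [h, ← h3]
  ring

end FractionalPower

/-! ### Identities and independence in inner product spaces -/

section InnerProduct

variable {E : Type*} [NormedAddCommGroup E] [InnerProductSpace ℝ E] {ι : Type*} [Fintype ι]

theorem exp_neg_mul_sq_norm_mul_exp (t : ℝ) (x y z : E) :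
    Real.exp (-(2 * t * ‖z - x‖ ^ 2)) * Real.exp (-(2 * t * ‖z - y‖ ^ 2)) =
      Real.exp (-(t * ‖x - y‖ ^ 2)) *
        Real.exp (-(4 * t * ‖z - (2 : ℝ)⁻¹ • (x + y)‖ ^ 2)) := by
  rw [← Real.exp_add, ← Real.exp_add]
  congr 1
  have h := parallelogram_law_with_norm ℝ (z - x) (z - y)
  have h1 : z - x + (z - y) = (2 : ℝ) • (z - (2 : ℝ)⁻¹ • (x + y)) := by module
  have h2 : z - x - (z - y) = -(x - y) := by abel
  rw [h1, h2, norm_smul, norm_neg, Real.norm_ofNat] at h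
  linear_combination t * h

/-- Distinct characters of the additive group are independent. Points may repeat, so only the net
weight on each fibre of `x` vanishes; an arbitrary `f` expresses this. -/
theorem sum_eq_zero_of_sum_mul_exp_inner_eq_zero (c : ι → ℝ) (x : ι → E)
    (h : ∀ z : E, ∑ i, c i * Real.exp (inner ℝ z (x i)) = 0) (f : E → ℝ) :
    ∑ i, c i * f (x i) = 0 := by
  classical
  let χ : E → (Multiplicative E →* ℝ) := fun v =>
    { toFun := fun z => Real.exp (inner ℝ z.toAdd v)
      map_one' := by simp
      map_mul' := fun a b => by simp [inner_add_left, Real.exp_add] }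
  have hχ : Function.Injective χ := fun v w hvw => by
    refine ext_inner_left ℝ fun z => Real.exp_injective ?_
    exact DFunLike.congr_fun hvw (Multiplicative.ofAdd z)
  have hli := (linearIndependent_monoidHom (Multiplicative E) ℝ).comp χ hχ
  have hfib : ∀ g : E → ℝ, ∑ i, c i * g (x i) =
      ∑ v ∈ Finset.univ.image x, (∑ i with x i = v, c i) * g v := by
    intro g
    rw [← Finset.sum_fiberwise_of_maps_to (g := x) (t := Finset.univ.image x)
      (fun i hi => Finset.mem_image_of_mem x hi)]
    refine Finset.sum_congr rfl fun v _ => ?_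
    rw [Finset.sum_mul]
    exact Finset.sum_congr rfl fun i hi => by rw [(Finset.mem_filter.1 hi).2]
  have hz := linearIndependent_iff'.1 hli (Finset.univ.image x)
    (fun v => ∑ i with x i = v, c i) (by
      funext z
      have := h z.toAdd
      rw [hfib fun v => Real.exp (inner ℝ z.toAdd v)] at this
      simpa [Finset.sum_apply, χ] using this)
  rw [hfib f]
  exact Finset.sum_eq_zero fun v hv => by rw [hz v hv, zero_mul]

theorem sum_mul_sq_norm_sub (c : ι → ℝ) (x : ι → E) (hc : ∑ i, c i = 0) :
    ∑ i, ∑ j, c i * c j * ‖x i - x j‖ ^ 2 = -(2 * ‖∑ i, c i • x i‖ ^ 2) := by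
  have h1 : ‖∑ i, c i • x i‖ ^ 2 = ∑ i, ∑ j, c i * c j * inner ℝ (x i) (x j) := by
    rw [← real_inner_self_eq_norm_sq, sum_inner]
    refine Finset.sum_congr rfl fun i _ => ?_
    rw [inner_sum]
    refine Finset.sum_congr rfl fun j _ => ?_
    rw [real_inner_smul_left, real_inner_smul_right, mul_assoc]
  have h2 : ∑ i, ∑ j, c i * c j * ‖x i‖ ^ 2 = 0 := by
    refine Finset.sum_eq_zero fun i _ => ?_
    rw [← Finset.sum_mul, ← Finset.mul_sum, hc, mul_zero, zero_mul]
  have h3 : ∑ i, ∑ j, c i * c j * ‖x j‖ ^ 2 = 0 := by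
    rw [Finset.sum_comm]
    refine Finset.sum_eq_zero fun i _ => ?_
    rw [← Finset.sum_mul, ← Finset.sum_mul, hc, zero_mul, zero_mul]
  have h4 : ∑ i, ∑ j, c i * c j * ‖x i - x j‖ ^ 2 = ∑ i, ∑ j, c i * c j * ‖x i‖ ^ 2 -
      2 * (∑ i, ∑ j, c i * c j * inner ℝ (x i) (x j)) + ∑ i, ∑ j, c i * c j * ‖x j‖ ^ 2 := by
    simp only [Finset.mul_sum, ← Finset.sum_sub_distrib, ← Finset.sum_add_distrib]
    refine Finset.sum_congr rfl fun i _ => Finset.sum_congr rfl fun j _ => ?_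
    rw [norm_sub_sq_real]
    ring
  rw [h4, h2, h3, h1]
  ring

end InnerProduct

section NormedGroup

variable {E : Type*} [NormedAddCommGroup E] {ι : Type*} [Fintype ι]

theorem sum_mul_norm_rpow_mul_integral {α : ℝ} (h0 : 0 < α) (h2 : α < 2) (c : ι → ℝ) (x : ι → E)
    (hc : ∑ i, c i = 0) :
    IntegrableOn (fun l : ℝ => (∑ i, ∑ j, c i * c j * Real.exp (-(l * ‖x i - x j‖ ^ 2))) *
        l ^ (-1 - α / 2)) (Ioi 0) ∧
    ∫ l in Ioi (0 : ℝ), (∑ i, ∑ j, c i * c j * Real.exp (-(l * ‖x i - x j‖ ^ 2))) *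
        l ^ (-1 - α / 2) =
      (-∑ i, ∑ j, c i * c j * ‖x i - x j‖ ^ α) *
        ∫ l in Ioi (0 : ℝ), (1 - Real.exp (-l)) * l ^ (-1 - α / 2) := by
  have hfun : (fun l : ℝ => (∑ i, ∑ j, c i * c j * Real.exp (-(l * ‖x i - x j‖ ^ 2))) *
        l ^ (-1 - α / 2)) = fun l => ∑ i, ∑ j, -(c i * c j) *
          ((1 - Real.exp (-(l * ‖x i - x j‖ ^ 2))) * l ^ (-1 - α / 2)) := by
    funext l
    -- Zero total weight lets each exponential be replaced by `-(1 - exp)`, which is integrable term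
    -- by term.
    have : ∑ i, ∑ j, c i * c j * l ^ (-1 - α / 2) = 0 := by
      simp_rw [← Finset.sum_mul, ← Finset.mul_sum, hc]
      simp
    rw [← sub_eq_zero, ← this, Finset.sum_mul, ← Finset.sum_sub_distrib]
    refine Finset.sum_congr rfl fun i _ => ?_
    rw [Finset.sum_mul, ← Finset.sum_sub_distrib]
    exact Finset.sum_congr rfl fun j _ => by ring
  have hint : ∀ i j, IntegrableOn (fun l : ℝ => -(c i * c j) *
      ((1 - Real.exp (-(l * ‖x i - x j‖ ^ 2))) * l ^ (-1 - α / 2))) (Ioi 0) := fun i j =>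
    (integrableOn_one_sub_exp_mul_rpow (by linarith) (by linarith) (sq_nonneg _)).const_mul _
  rw [hfun]
  refine ⟨integrable_finsetSum _ fun i _ => integrable_finsetSum _ fun j _ => hint i j, ?_⟩
  rw [integral_finsetSum _ fun i _ => integrable_finsetSum _ fun j _ => hint i j,
    ← Finset.sum_neg_distrib, Finset.sum_mul]
  refine Finset.sum_congr rfl fun i _ => ?_
  rw [integral_finsetSum _ fun j _ => hint i j, ← Finset.sum_neg_distrib, Finset.sum_mul]
  refine Finset.sum_congr rfl fun j _ => ?_
  rw [integral_const_mul, integral_one_sub_exp_mul_rpow (by linarith) (sq_nonneg _),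
    ← Real.rpow_natCast_mul (norm_nonneg _)]
  rw [show ((2 : ℕ) : ℝ) * (α / 2) = α by push_cast; ring]
  ring

end NormedGroup

/-! ### Gaussian quadratic forms -/

section Gaussian

variable {E : Type*} [NormedAddCommGroup E] [InnerProductSpace ℝ E] [FiniteDimensional ℝ E]
  [MeasurableSpace E] [BorelSpace E]

theorem integrable_exp_neg_mul_sq_norm {b : ℝ} (hb : 0 < b) :
    Integrable (fun z : E => Real.exp (-(b * ‖z‖ ^ 2))) := by
  have h := (GaussianFourier.integrable_cexp_neg_mul_sq_norm_add (V := E) (b := (b : ℂ))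
    (by simpa using hb) 0 0).re
  refine h.congr (Filter.Eventually.of_forall fun z => ?_)
  simp only [zero_mul, add_zero, RCLike.re_eq_complex_re]
  rw [← Complex.ofReal_re (Real.exp _)]
  push_cast
  ring_nf

variable {ι : Type*} [Fintype ι]

/-- A product of two Gaussians is a Gaussian about the midpoint, whose integral does not depend on
its centre. -/
theorem integral_sq_sum_gaussian {t : ℝ} (ht : 0 < t) (c : ι → ℝ) (x : ι → E) :
    Integrable (fun z : E => (∑ i, c i * Real.exp (-(2 * t * ‖z - x i‖ ^ 2))) ^ 2) ∧
    ∫ z : E, (∑ i, c i * Real.exp (-(2 * t * ‖z - x i‖ ^ 2))) ^ 2 =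
      (∑ i, ∑ j, c i * c j * Real.exp (-(t * ‖x i - x j‖ ^ 2))) *
        ∫ z : E, Real.exp (-(4 * t * ‖z‖ ^ 2)) := by
  have hI : ∀ w : E, Integrable (fun z : E => Real.exp (-(4 * t * ‖z - w‖ ^ 2))) := fun w =>
    (integrable_exp_neg_mul_sq_norm (E := E) (show 0 < 4 * t by linarith)).comp_sub_right w
  have hexp : (fun z : E => (∑ i, c i * Real.exp (-(2 * t * ‖z - x i‖ ^ 2))) ^ 2) =
      fun z => ∑ i, ∑ j, c i * c j * Real.exp (-(t * ‖x i - x j‖ ^ 2)) *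
        Real.exp (-(4 * t * ‖z - (2 : ℝ)⁻¹ • (x i + x j)‖ ^ 2)) := by
    funext z
    rw [sq, Finset.sum_mul_sum]
    refine Finset.sum_congr rfl fun i _ => Finset.sum_congr rfl fun j _ => ?_
    linear_combination (c i * c j) * exp_neg_mul_sq_norm_mul_exp t (x i) (x j) z
  have hint : ∀ i j, Integrable (fun z : E => c i * c j * Real.exp (-(t * ‖x i - x j‖ ^ 2)) *
        Real.exp (-(4 * t * ‖z - (2 : ℝ)⁻¹ • (x i + x j)‖ ^ 2))) := fun i j =>
    (hI _).const_mul _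
  rw [hexp]
  refine ⟨integrable_finsetSum _ fun i _ => integrable_finsetSum _ fun j _ => hint i j, ?_⟩
  rw [integral_finsetSum _ fun i _ => integrable_finsetSum _ fun j _ => hint i j, Finset.sum_mul]
  refine Finset.sum_congr rfl fun i _ => ?_
  rw [integral_finsetSum _ fun j _ => hint i j, Finset.sum_mul]
  refine Finset.sum_congr rfl fun j _ => ?_
  rw [integral_const_mul, integral_sub_right_eq_self (fun z : E => Real.exp (-(4 * t * ‖z‖ ^ 2)))]

theorem integral_exp_neg_mul_sq_norm_pos {b : ℝ} (hb : 0 < b) :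
    0 < ∫ z : E, Real.exp (-(b * ‖z‖ ^ 2)) :=
  integral_exp_pos (integrable_exp_neg_mul_sq_norm hb)

theorem gaussian_quadratic_form_nonneg {t : ℝ} (ht : 0 < t) (c : ι → ℝ) (x : ι → E) :
    0 ≤ ∑ i, ∑ j, c i * c j * Real.exp (-(t * ‖x i - x j‖ ^ 2)) := by
  refine nonneg_of_mul_nonneg_left (b := ∫ z : E, Real.exp (-(4 * t * ‖z‖ ^ 2))) ?_
    (integral_exp_neg_mul_sq_norm_pos (by linarith))
  rw [← (integral_sq_sum_gaussian ht c x).2]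
  exact integral_nonneg fun z => sq_nonneg _

theorem sum_eq_zero_of_gaussian_quadratic_form_eq_zero {t : ℝ} (ht : 0 < t) (c : ι → ℝ)
    (x : ι → E) (h : ∑ i, ∑ j, c i * c j * Real.exp (-(t * ‖x i - x j‖ ^ 2)) = 0)
    (f : E → ℝ) : ∑ i, c i * f (x i) = 0 := by
  obtain ⟨hint, heq⟩ := integral_sq_sum_gaussian ht c x
  rw [h, zero_mul, integral_eq_zero_iff_of_nonneg (fun z => sq_nonneg _) hint] at heq
  have hcont : Continuous fun z : E =>
      (∑ i, c i * Real.exp (-(2 * t * ‖z - x i‖ ^ 2))) ^ 2 := by fun_prop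
  have hzero := (Continuous.ae_eq_iff_eq volume hcont continuous_zero).1 heq
  have key := sum_eq_zero_of_sum_mul_exp_inner_eq_zero
    (fun i => c i * Real.exp (-(2 * t * ‖x i‖ ^ 2))) x (fun z => by
      have h1 := pow_eq_zero_iff (two_ne_zero) |>.1 (congrFun hzero ((4 * t)⁻¹ • z))
      have h2 : ∑ i, c i * Real.exp (-(2 * t * ‖(4 * t)⁻¹ • z - x i‖ ^ 2)) =
          Real.exp (-(2 * t * ‖(4 * t)⁻¹ • z‖ ^ 2)) *
            ∑ i, c i * Real.exp (-(2 * t * ‖x i‖ ^ 2)) * Real.exp (inner ℝ z (x i)) := by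
        rw [Finset.mul_sum]
        refine Finset.sum_congr rfl fun i _ => ?_
        have : Real.exp (-(2 * t * ‖(4 * t)⁻¹ • z - x i‖ ^ 2)) =
            Real.exp (-(2 * t * ‖(4 * t)⁻¹ • z‖ ^ 2)) * Real.exp (-(2 * t * ‖x i‖ ^ 2)) *
              Real.exp (inner ℝ z (x i)) := by
          rw [← Real.exp_add, ← Real.exp_add, norm_sub_sq_real, real_inner_smul_left]
          congr 1
          field_simp
          ring
        rw [this]
        ring
      rw [h2] at h1
      exact (mul_eq_zero.1 h1).resolve_left (Real.exp_ne_zero _))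
    -- This test function cancels the Gaussian factor absorbed into the weights.
    (fun v => f v * Real.exp (2 * t * ‖v‖ ^ 2))
  rw [← key]
  refine Finset.sum_congr rfl fun i _ => ?_
  rw [Real.exp_neg]
  field_simp

theorem ae_nonneg_gaussian_mixture (α : ℝ) (c : ι → ℝ) (x : ι → E) :
    0 ≤ᵐ[volume.restrict (Ioi (0 : ℝ))] fun l : ℝ =>
      (∑ i, ∑ j, c i * c j * Real.exp (-(l * ‖x i - x j‖ ^ 2))) * l ^ (-1 - α / 2) := by
  filter_upwards [ae_restrict_mem measurableSet_Ioi] with l hl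
  exact mul_nonneg (gaussian_quadratic_form_nonneg hl c x) (Real.rpow_nonneg (le_of_lt hl) _)

theorem sum_mul_norm_rpow_nonpos {α : ℝ} (h0 : 0 < α) (h2 : α < 2) (c : ι → ℝ) (x : ι → E)
    (hc : ∑ i, c i = 0) : ∑ i, ∑ j, c i * c j * ‖x i - x j‖ ^ α ≤ 0 := by
  refine neg_nonneg.1 (nonneg_of_mul_nonneg_left ?_
    (integral_one_sub_exp_mul_rpow_pos (s := α / 2) (by linarith) (by linarith)))
  rw [← (sum_mul_norm_rpow_mul_integral h0 h2 c x hc).2]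
  exact integral_nonneg_of_ae (ae_nonneg_gaussian_mixture α c x)

theorem sum_eq_zero_of_sum_mul_norm_rpow_eq_zero {α : ℝ} (h0 : 0 < α) (h2 : α < 2) (c : ι → ℝ)
    (x : ι → E) (hc : ∑ i, c i = 0) (h : ∑ i, ∑ j, c i * c j * ‖x i - x j‖ ^ α = 0)
    (f : E → ℝ) : ∑ i, c i * f (x i) = 0 := by
  obtain ⟨hint, heq⟩ := sum_mul_norm_rpow_mul_integral h0 h2 c x hc
  rw [h, neg_zero, zero_mul,
    integral_eq_zero_iff_of_nonneg_ae (ae_nonneg_gaussian_mixture α c x) hint] at heq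
  have hne : (ae (volume.restrict (Ioi (0 : ℝ)))).NeBot := by
    rw [ae_neBot, Ne, Measure.restrict_eq_zero]
    simp
  obtain ⟨l, hl, hl0⟩ := (heq.and (ae_restrict_mem measurableSet_Ioi)).exists
  exact sum_eq_zero_of_gaussian_quadratic_form_eq_zero hl0 c x
    ((mul_eq_zero.1 hl).resolve_right (Real.rpow_pos_of_pos hl0 _).ne') f

end Gaussian

/-! ### Comparison of two samples -/

section TwoSamples

variable {p m n : ℕ}

/-- The weights `1 / m` and `-1 / n` of the difference of two empirical distributions. -/
noncomputable def diffWeight (m n : ℕ) : Fin m ⊕ Fin n → ℝ :=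
  Sum.elim (fun _ => (m : ℝ)⁻¹) fun _ => -(n : ℝ)⁻¹

theorem sum_diffWeight_mul (a : Fin m → EuclideanSpace ℝ (Fin p))
    (b : Fin n → EuclideanSpace ℝ (Fin p)) (f : EuclideanSpace ℝ (Fin p) → ℝ) :
    ∑ i, diffWeight m n i * f (Sum.elim a b i) =
      (m : ℝ)⁻¹ * ∑ i, f (a i) - (n : ℝ)⁻¹ * ∑ i, f (b i) := by
  simp [diffWeight, Finset.mul_sum, sub_eq_add_neg]

theorem sum_diffWeight_smul (a : Fin m → EuclideanSpace ℝ (Fin p))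
    (b : Fin n → EuclideanSpace ℝ (Fin p)) :
    ∑ i, diffWeight m n i • Sum.elim a b i = sampleMean a - sampleMean b := by
  simp [diffWeight, sampleMean, Finset.smul_sum, sub_eq_add_neg]

theorem sum_diffWeight (hm : 1 ≤ m) (hn : 1 ≤ n) : ∑ i, diffWeight m n i = 0 := by
  have h1 : (m : ℝ) ≠ 0 := by positivity
  have h2 : (n : ℝ) ≠ 0 := by positivity
  simp [diffWeight, h1, h2]

theorem two_mul_gini_sub_gini_sub_gini (α : ℝ) (a : Fin m → EuclideanSpace ℝ (Fin p))
    (b : Fin n → EuclideanSpace ℝ (Fin p)) :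
    2 * gini α a b - gini α a a - gini α b b =
      -∑ i, ∑ j, diffWeight m n i * diffWeight m n j *
        ‖Sum.elim a b i - Sum.elim a b j‖ ^ α := by
  have hcomm : ∑ i, ∑ j, ‖b i - a j‖ ^ α = ∑ i, ∑ j, ‖a i - b j‖ ^ α := by
    rw [Finset.sum_comm]
    simp_rw [norm_sub_rev]
  simp only [gini, diffWeight, Fintype.sum_sum_type, Sum.elim_inl, Sum.elim_inr,
    Finset.sum_add_distrib, ← Finset.mul_sum, hcomm]
  simp only [one_div, mul_inv]
  ring

theorem sum_div_eq_of_empiricalDistribution_eq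
    {a : Fin m → EuclideanSpace ℝ (Fin p)} {b : Fin n → EuclideanSpace ℝ (Fin p)}
    (h : empiricalDistribution a = empiricalDistribution b)
    (f : EuclideanSpace ℝ (Fin p) → ℝ) :
    (m : ℝ)⁻¹ * ∑ i, f (a i) = (n : ℝ)⁻¹ * ∑ i, f (b i) := by
  have key : ∀ {k : ℕ} (c : Fin k → EuclideanSpace ℝ (Fin p)),
      ∫ x, f x ∂(empiricalDistribution c) = (k : ℝ)⁻¹ * ∑ i, f (c i) := by
    intro k c
    -- Singletons are measurable, so any `f` is integrable against a Dirac mass.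
    rw [empiricalDistribution, integral_smul_measure,
      integral_finsetSum_measure fun i _ => integrable_dirac (by simp)]
    simp [integral_dirac]
  rw [← key a, ← key b, h]

theorem empiricalDistribution_eq_of_sum_div_eq (hm : 1 ≤ m) (hn : 1 ≤ n)
    {a : Fin m → EuclideanSpace ℝ (Fin p)} {b : Fin n → EuclideanSpace ℝ (Fin p)}
    (h : ∀ f : EuclideanSpace ℝ (Fin p) → ℝ,
      (m : ℝ)⁻¹ * ∑ i, f (a i) = (n : ℝ)⁻¹ * ∑ i, f (b i)) :
    empiricalDistribution a = empiricalDistribution b := by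
  have key : ∀ {k : ℕ} (_ : 1 ≤ k) (c : Fin k → EuclideanSpace ℝ (Fin p))
      (s : Set (EuclideanSpace ℝ (Fin p))), MeasurableSet s →
      empiricalDistribution c s =
        ENNReal.ofReal ((k : ℝ)⁻¹ * ∑ i, s.indicator (fun _ => (1 : ℝ)) (c i)) := by
    intro k hk c s hs
    have hk' : (0 : ℝ) < k := by positivity
    have hind : ∀ x, 0 ≤ s.indicator (fun _ => (1 : ℝ)) x := fun x =>
      Set.indicator_nonneg (fun _ _ => zero_le_one) x
    rw [ENNReal.ofReal_mul (by positivity), ENNReal.ofReal_inv_of_pos hk', ENNReal.ofReal_natCast,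
      ENNReal.ofReal_sum_of_nonneg fun i _ => hind _]
    simp only [empiricalDistribution, Measure.smul_apply, Measure.finsetSum_apply, smul_eq_mul,
      Measure.dirac_apply' _ hs]
    congr 1
    refine Finset.sum_congr rfl fun i _ => ?_
    by_cases hi : c i ∈ s <;> simp [hi]
  ext s hs
  rw [key hm a s hs, key hn b s hs, h]

theorem dDist_eq (α : ℝ) (a : Fin m → EuclideanSpace ℝ (Fin p))
    (b : Fin n → EuclideanSpace ℝ (Fin p)) :
    dDist α a b = ((m : ℝ) * n / (m + n)) *
      -∑ i, ∑ j, diffWeight m n i * diffWeight m n j *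
        ‖Sum.elim a b i - Sum.elim a b j‖ ^ α := by
  rw [dDist, two_mul_gini_sub_gini_sub_gini]

theorem dDist_two (hm : 1 ≤ m) (hn : 1 ≤ n) (a : Fin m → EuclideanSpace ℝ (Fin p))
    (b : Fin n → EuclideanSpace ℝ (Fin p)) :
    dDist 2 a b = ((m : ℝ) * n / (m + n)) * (2 * ‖sampleMean a - sampleMean b‖ ^ 2) := by
  simp_rw [dDist_eq, Real.rpow_two]
  rw [sum_mul_sq_norm_sub _ _ (sum_diffWeight hm hn), sum_diffWeight_smul, neg_neg]

theorem dDist_nonneg (hm : 1 ≤ m) (hn : 1 ≤ n) {α : ℝ} (h0 : 0 < α) (h2 : α ≤ 2)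
    (a : Fin m → EuclideanSpace ℝ (Fin p)) (b : Fin n → EuclideanSpace ℝ (Fin p)) :
    0 ≤ dDist α a b := by
  rcases h2.eq_or_lt with rfl | h2
  · rw [dDist_two hm hn]
    positivity
  · rw [dDist_eq]
    exact mul_nonneg (by positivity)
      (neg_nonneg.2 (sum_mul_norm_rpow_nonpos h0 h2 _ _ (sum_diffWeight hm hn)))

theorem dDist_eq_zero_iff (hm : 1 ≤ m) (hn : 1 ≤ n) {α : ℝ} (h0 : 0 < α) (h2 : α < 2)
    (a : Fin m → EuclideanSpace ℝ (Fin p)) (b : Fin n → EuclideanSpace ℝ (Fin p)) :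
    dDist α a b = 0 ↔ empiricalDistribution a = empiricalDistribution b := by
  have hpos : (m : ℝ) * n / (m + n) ≠ 0 := by positivity
  rw [dDist_eq, mul_eq_zero, or_iff_right hpos, neg_eq_zero]
  constructor
  · intro h
    refine empiricalDistribution_eq_of_sum_div_eq hm hn fun f => ?_
    rw [← sub_eq_zero, ← sum_diffWeight_mul]
    exact sum_eq_zero_of_sum_mul_norm_rpow_eq_zero h0 h2 _ _ (sum_diffWeight hm hn) h f
  · intro h
    -- For fixed `i` the inner sum is a difference of two sample averages of one function.
    refine Finset.sum_eq_zero fun i _ => ?_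
    simp_rw [mul_assoc, ← Finset.mul_sum]
    rw [sum_diffWeight_mul a b fun v => ‖Sum.elim a b i - v‖ ^ α,
      
      sum_div_eq_of_empiricalDistribution_eq h fun v => ‖Sum.elim a b i - v‖ ^ α, sub_self, mul_zero]

theorem dDist_two_eq_zero_iff (hm : 1 ≤ m) (hn : 1 ≤ n) (a : Fin m → EuclideanSpace ℝ (Fin p))
    (b : Fin n → EuclideanSpace ℝ (Fin p)) :
    dDist 2 a b = 0 ↔ sampleMean a = sampleMean b := by
  have hpos : (m : ℝ) * n / (m + n) ≠ 0 := by positivity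
  rw [dDist_two hm hn, mul_eq_zero, or_iff_right hpos, mul_eq_zero, or_iff_right two_ne_zero,
    pow_eq_zero_iff two_ne_zero, norm_eq_zero, sub_eq_zero]

end TwoSamples

/-! ### Sums over pairs of samples -/

section ManySamples

variable {p K : ℕ} {n : Fin K → ℕ}

theorem pairWeight_pos (hn : ∀ j, 1 ≤ n j) (j k : Fin K) :
    0 < ((n j : ℝ) + n k) / (2 * ∑ i, (n i : ℝ)) := by
  have hpos : ∀ i, (0 : ℝ) < n i := fun i => by exact_mod_cast hn i
  have hsum : 0 < ∑ i, (n i : ℝ) := Finset.sum_pos (fun i _ => hpos i) ⟨j, Finset.mem_univ j⟩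
  have := hpos j
  have := hpos k
  positivity

theorem betweenDispersion_nonneg (hn : ∀ j, 1 ≤ n j) {α : ℝ} (h0 : 0 < α) (h2 : α ≤ 2)
    (A : (j : Fin K) → Fin (n j) → EuclideanSpace ℝ (Fin p)) :
    0 ≤ betweenDispersion α n A :=
  Finset.sum_nonneg fun j _ => Finset.sum_nonneg fun k _ =>
    mul_nonneg (pairWeight_pos hn j k).le (dDist_nonneg (hn j) (hn k) h0 h2 _ _)

theorem betweenDispersion_eq_zero_iff (hn : ∀ j, 1 ≤ n j) {α : ℝ} (h0 : 0 < α) (h2 : α ≤ 2)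
    (A : (j : Fin K) → Fin (n j) → EuclideanSpace ℝ (Fin p)) :
    betweenDispersion α n A = 0 ↔ ∀ j k : Fin K, j < k → dDist α (A j) (A k) = 0 := by
  have hterm : ∀ j k : Fin K,
      0 ≤ (((n j : ℝ) + n k) / (2 * ∑ i, (n i : ℝ))) * dDist α (A j) (A k) := fun j k =>
    mul_nonneg (pairWeight_pos hn j k).le (dDist_nonneg (hn j) (hn k) h0 h2 _ _)
  rw [betweenDispersion,
    Finset.sum_eq_zero_iff_of_nonneg fun j _ => Finset.sum_nonneg fun k _ => hterm j k]
  simp only [Finset.sum_eq_zero_iff_of_nonneg fun k _ => hterm _ k, Finset.mem_univ,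
    Finset.mem_filter, true_and, forall_const, mul_eq_zero, (pairWeight_pos hn _ _).ne', false_or]

end ManySamples

theorem forall_lt_eq_iff {ι β : Type*} [LinearOrder ι] (f : ι → β) :
    (∀ j k, j < k → f j = f k) ↔ ∀ j k, f j = f k := by
  refine ⟨fun h j k => ?_, fun h j k _ => h j k⟩
  rcases lt_trichotomy j k with hjk | rfl | hjk
  exacts [h j k hjk, rfl, (h k j hjk).symm]

end Disco

theorem corollary1 (p K : ℕ) (hK : 2 ≤ K) (n : Fin K → ℕ) (hn : ∀ j, 1 ≤ n j)
    (A : (j : Fin K) → Fin (n j) → EuclideanSpace ℝ (Fin p)) :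
    (∀ α : ℝ, 0 < α → α ≤ 2 → 0 ≤ Disco.betweenDispersion α n A) ∧
    (∀ α : ℝ, 0 < α → α < 2 →
      (Disco.betweenDispersion α n A = 0 ↔
        ∀ j k : Fin K,
          Disco.empiricalDistribution (A j) = Disco.empiricalDistribution (A k))) ∧
    (Disco.betweenDispersion 2 n A = 0 ↔
      ∀ j k : Fin K, Disco.sampleMean (A j) = Disco.sampleMean (A k)) := by
  refine ⟨fun α h0 h2 => Disco.betweenDispersion_nonneg hn h0 h2 A, fun α h0 h2 => ?_, ?_⟩
  · rw [Disco.betweenDispersion_eq_zero_iff hn h0 h2.le,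
      ← Disco.forall_lt_eq_iff fun j => Disco.empiricalDistribution (A j)]
    simp only [Disco.dDist_eq_zero_iff (hn _) (hn _) h0 h2]
  · rw [Disco.betweenDispersion_eq_zero_iff hn two_pos le_rfl,
      ← Disco.forall_lt_eq_iff fun j => Disco.sampleMean (A j)]
    simp only [Disco.dDist_two_eq_zero_iff (hn _) (hn _)]
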